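/- Let $G\rightrightarrows M$ be a Hausdorff (finite-dimensional, smooth) Lie groupoid with source and target maps $\mathsf s,\mathsf t\colon G\to M$, where $gh$ is defined when $\mathsf s(g)=\mathsf t(h)$. For $p\ge 1$ let $B_pG=\{(g_1,\dots,g_p)\in G^p \mid \mathsf s(g_i)=\mathsf t(g_{i+1}),\ 0<i<p\}$, an embedded submanifold of $G^p$, and let $B_0G=M$. A $p$-arrow has base points $m_0,\dots,m_p$, where $m_i=\mathsf s(g_i)$ for $i>0$ and $m_i=\mathsf t(g_{i+1})$ for $i<p$ (for $p=0$, $m_0$ is the point of $M$ itself). The face map $\partial_i\colon B_{p}G\to B_{p-1}G$ ($0\le i\le p$) drops the $i$-th base point: for $p\ge2$ it drops $g_1$ if $i=0$, drops $g_p$ if $i=p$, and replaces the pair $g_i,g_{i+1}$ by $g_ig_{i+1}$ otherwise, while $\partial_0=\mathsf s$ and $\partial_1=\mathsf t$ for $p=1$. The groupoid complex $(\mathsf C(G),\delta)$ has $\mathsf C^p(G)=C^\infty(B_pG)$ (real-valued functions) and $\delta=\sum_{i=0}^{p+1}(-1)^i\partial_i^*$ on $\mathsf C^p(G)$. There are $p+1$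 commuting right actions of $G$ on $B_pG$; for $0\le i\le p$, the $i$-th action is defined for $a\in G$ with $\mathsf t(a)=m_i$, and it replaces $g_i$ by $g_ia$ (if $i>0$), $g_{i+1}$ by $a^{-1}g_{i+1}$ (if $i<p$), and hence $m_i$ by $\mathsf s(a)$ (for $p=0$: $\mathsf t(a)\cdot a=\mathsf s(a)$). Let $K\subset G$ be a wide Lie subgroupoid, i.e. a Hausdorff Lie groupoid $K\rightrightarrows M$ with the same base together with an injective immersion $K\hookrightarrow G$ that is a morphism of Lie groupoids over $\mathrm{id}_M$. Let $\mathsf C(G)^K\subset\mathsf C(G)$ be the subcomplex whose degree $p$ part consists of the $f\in C^\infty(B_pG)$ invariant under the restrictions to $K$ of all $p+1$ actions, and let $\widetilde{\mathsf C}(G)^K\subset\mathsf C(G)^K$ be the subcomplex of those $f$ with $f(g_1,\dots,g_p)=0$ whenever $g_i\in K$ for some $i$. Theorem. The inclusion $\iota\colon\widetilde{\mathsf C}(G)^K\to\mathsf C(G)^K$ is a homotopy equivalence of cochain complexes of real vector spaces. -/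

import Mathlib

open scoped Manifold ContDiff
open CategoryTheory

/-! ### Smooth maps into and out of finite powers of a manifold -/

section PiManifold

variable {ι : Type*} [Fintype ι]
  {E : Type*} [NormedAddCommGroup E] [NormedSpace ℝ E]
  {X : Type*} [TopologicalSpace X] [ChartedSpace E X]
  {E' : Type*} [NormedAddCommGroup E'] [NormedSpace ℝ E']
  {H' : Type*} [TopologicalSpace H'] {I' : ModelWithCorners ℝ E' H'}
  {Y : Type*} [TopologicalSpace Y] [ChartedSpace H' Y]

/-- A map into a finite power of a manifold is smooth on a set if its components are. -/
theorem contMDiffOn_powerManifold {f : Y → ι → X} {S : Set Y}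
    (hf : ∀ i, ContMDiffOn I' 𝓘(ℝ, E) ∞ (fun y => f y i) S) :
    ContMDiffOn I' (ModelWithCorners.pi fun _ : ι => 𝓘(ℝ, E)) ∞ f S := by
  intro y hy
  rw [contMDiffWithinAt_iff]
  refine ⟨continuousWithinAt_pi.2 fun i => (hf i y hy).continuousWithinAt, ?_⟩
  rw [contDiffWithinAt_pi]
  intro i
  have h := ((contMDiffWithinAt_iff (I := I') (I' := 𝓘(ℝ, E))).1 (hf i y hy)).2
  exact h

/-- The coordinate projections of a finite power of a manifold are smooth. -/
theorem contMDiff_powerManifold_apply (i : ι) :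
    ContMDiff (ModelWithCorners.pi fun _ : ι => 𝓘(ℝ, E)) 𝓘(ℝ, E) ∞ (fun x : ι → X => x i) := by
  intro x
  rw [← contMDiffWithinAt_univ, contMDiffWithinAt_iff]
  refine ⟨(continuous_apply i).continuousWithinAt, ?_⟩
  have h : ContDiffWithinAt ℝ ∞ (fun v : ι → E => v i)
      (((extChartAt (ModelWithCorners.pi fun _ : ι => 𝓘(ℝ, E)) x).symm ⁻¹' Set.univ) ∩
        Set.range (ModelWithCorners.pi fun _ : ι => 𝓘(ℝ, E)))
      (extChartAt (ModelWithCorners.pi fun _ : ι => 𝓘(ℝ, E)) x x) :=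
    (contDiff_apply ℝ E i).contDiffWithinAt
  have key : ∀ v ∈ (extChartAt (ModelWithCorners.pi fun _ : ι => 𝓘(ℝ, E)) x).target,
      (extChartAt 𝓘(ℝ, E) (x i) ∘ (fun x : ι → X => x i) ∘
        (extChartAt (ModelWithCorners.pi fun _ : ι => 𝓘(ℝ, E)) x).symm) v = v i := fun v hv =>
    congrFun ((extChartAt (ModelWithCorners.pi fun _ : ι => 𝓘(ℝ, E)) x).right_inv hv) i
  refine h.congr_of_eventuallyEq ?_ (key _ (mem_extChartAt_target x))
  rw [Set.preimage_univ, Set.univ_inter]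
  filter_upwards [extChartAt_target_mem_nhdsWithin (I := ModelWithCorners.pi
    fun _ : ι => 𝓘(ℝ, E)) x] with v hv using key v hv

end PiManifold

/-! ### Lie groupoids and wide Lie subgroupoids -/

section Groupoid

/-- A Lie groupoid `G ⇉ M`. The product `mul g h` is meaningful only for composable arrows, that is
when `source g = target h`: all axioms, and smoothness, concern composable arrows only.
The set of composable pairs is an embedded submanifold of `G × G`, and smoothness of the product on
this submanifold is `ContMDiffOn`. -/
structure LieGroupoid (EG EM G M : Type*)
    [NormedAddCommGroup EG] [NormedSpace ℝ EG] [FiniteDimensional ℝ EG]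
    [NormedAddCommGroup EM] [NormedSpace ℝ EM] [FiniteDimensional ℝ EM]
    [TopologicalSpace G] [ChartedSpace EG G] [IsManifold 𝓘(ℝ, EG) ∞ G] [T2Space G]
    [TopologicalSpace M] [ChartedSpace EM M] [IsManifold 𝓘(ℝ, EM) ∞ M] [T2Space M] where
  source : G → M
  target : G → M
  unit : M → G
  inv : G → G
  mul : G → G → G
  source_unit : ∀ m, source (unit m) = m
  target_unit : ∀ m, target (unit m) = m
  source_inv : ∀ g, source (inv g) = target g
  target_inv : ∀ g, target (inv g) = source g
  source_mul : ∀ g h, source g = target h → source (mul g h) = source h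
  target_mul : ∀ g h, source g = target h → target (mul g h) = target g
  mul_assoc : ∀ g h k, source g = target h → source h = target k →
    mul (mul g h) k = mul g (mul h k)
  unit_mul : ∀ g, mul (unit (target g)) g = g
  mul_unit : ∀ g, mul g (unit (source g)) = g
  inv_mul : ∀ g, mul (inv g) g = unit (source g)
  mul_inv : ∀ g, mul g (inv g) = unit (target g)
  isSubmersion_source : Manifold.IsSubmersion 𝓘(ℝ, EG) 𝓘(ℝ, EM) ∞ source
  isSubmersion_target : Manifold.IsSubmersion 𝓘(ℝ, EG) 𝓘(ℝ, EM) ∞ target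
  contMDiff_unit : ContMDiff 𝓘(ℝ, EM) 𝓘(ℝ, EG) ∞ unit
  contMDiff_inv : ContMDiff 𝓘(ℝ, EG) 𝓘(ℝ, EG) ∞ inv
  contMDiffOn_mul : ContMDiffOn (𝓘(ℝ, EG).prod 𝓘(ℝ, EG)) 𝓘(ℝ, EG) ∞
    (fun gh : G × G => mul gh.1 gh.2) {gh | source gh.1 = target gh.2}

variable {EG EM G M : Type*}
  [NormedAddCommGroup EG] [NormedSpace ℝ EG] [FiniteDimensional ℝ EG]
  [NormedAddCommGroup EM] [NormedSpace ℝ EM] [FiniteDimensional ℝ EM]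
  [TopologicalSpace G] [ChartedSpace EG G] [IsManifold 𝓘(ℝ, EG) ∞ G] [T2Space G]
  [TopologicalSpace M] [ChartedSpace EM M] [IsManifold 𝓘(ℝ, EM) ∞ M] [T2Space M]

/-- A wide Lie subgroupoid of `𝒢`: a Lie groupoid `K ⇉ M` over the same base, with an injective
immersion `K → G` that is a morphism of groupoids over the identity of `M`. -/
structure WideLieSubgroupoid (EK K : Type*)
    [NormedAddCommGroup EK] [NormedSpace ℝ EK] [FiniteDimensional ℝ EK]
    [TopologicalSpace K] [ChartedSpace EK K] [IsManifold 𝓘(ℝ, EK) ∞ K] [T2Space K]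
    (𝒢 : LieGroupoid EG EM G M) extends LieGroupoid EK EM K M where
  incl : K → G
  incl_injective : Function.Injective incl
  isImmersion_incl : Manifold.IsImmersion 𝓘(ℝ, EK) 𝓘(ℝ, EG) ∞ incl
  source_incl : ∀ k, 𝒢.source (incl k) = source k
  target_incl : ∀ k, 𝒢.target (incl k) = target k
  incl_unit : ∀ m, incl (unit m) = 𝒢.unit m
  incl_mul : ∀ k l, source k = target l → incl (mul k l) = 𝒢.mul (incl k) (incl l)

/-- The arrows of `G` that lie in the subgroupoid `K`. -/
def WideLieSubgroupoid.arrows {EK K : Type*}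
    [NormedAddCommGroup EK] [NormedSpace ℝ EK] [FiniteDimensional ℝ EK]
    [TopologicalSpace K] [ChartedSpace EK K] [IsManifold 𝓘(ℝ, EK) ∞ K] [T2Space K]
    {𝒢 : LieGroupoid EG EM G M} (𝒦 : WideLieSubgroupoid EK K 𝒢) : Set G :=
  Set.range 𝒦.incl

namespace LieGroupoid

variable (𝒢 : LieGroupoid EG EM G M)

/-! ### The nerve -/

/-- The space `B_p G` of `p`-arrows `(g₁, …, g_p)`, each recorded together with its base points
`(m₀, …, m_p)`, where `g_i` has target `m_{i-1}` and source `m_i`. (In Lean the arrows are numbered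
from `0`, so `x.2 i` has target `x.1 i` and source `x.1 (i + 1)`.)  For `p > 0` the base points are
determined by the arrows, and for `p = 0` this is `M`. -/
def nerve (p : ℕ) : Set ((Fin (p + 1) → M) × (Fin p → G)) :=
  {x | ∀ i : Fin p, 𝒢.target (x.2 i) = x.1 i.castSucc ∧ 𝒢.source (x.2 i) = x.1 i.succ}

/-- The arrows of the `i`-th face of a `(p+1)`-arrow: drop the first arrow if `i = 0`, drop the last
one if `i = p + 1`, and compose `g_i` and `g_{i+1}` otherwise. -/
def faceArrows {p : ℕ} (i : Fin (p + 2)) (g : Fin (p + 1) → G) : Fin p → G := fun k =>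
  if (k : ℕ) + 1 < i then g k.castSucc
  else if (k : ℕ) + 1 = i then 𝒢.mul (g k.castSucc) (g k.succ)
  else g k.succ

theorem face_mem {p : ℕ} (i : Fin (p + 2)) {x : (Fin (p + 2) → M) × (Fin (p + 1) → G)}
    (hx : x ∈ 𝒢.nerve (p + 1)) :
    ((fun j => x.1 (i.succAbove j), 𝒢.faceArrows i x.2) :
      (Fin (p + 1) → M) × (Fin p → G)) ∈ 𝒢.nerve p := by
  intro k
  have h1 := hx k.castSucc
  have h2 := hx k.succ
  have hc : 𝒢.source (x.2 k.castSucc) = 𝒢.target (x.2 k.succ) := by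
    rw [h1.2, h2.1, Fin.succ_castSucc]
  simp only [faceArrows]
  rcases lt_trichotomy ((k : ℕ) + 1) i with h | h | h
  · rw [if_pos h, Fin.succAbove_of_castSucc_lt _ _ (by simp [Fin.lt_def]; omega),
      Fin.succAbove_of_castSucc_lt _ _ (by simp [Fin.lt_def]; omega)]
    exact ⟨h1.1, by rw [h1.2, Fin.succ_castSucc]⟩
  · rw [if_neg (by omega), if_pos h, Fin.succAbove_of_castSucc_lt _ _ (by simp [Fin.lt_def]; omega),
      Fin.succAbove_of_le_castSucc _ _ (by simp [Fin.le_def]; omega)]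
    exact ⟨by rw [𝒢.target_mul _ _ hc, h1.1], by rw [𝒢.source_mul _ _ hc, h2.2]⟩
  · rw [if_neg (by omega), if_neg (by omega),
      Fin.succAbove_of_le_castSucc _ _ (by simp [Fin.le_def]; omega),
      Fin.succAbove_of_le_castSucc _ _ (by simp [Fin.le_def]; omega)]
    exact ⟨by rw [h2.1, Fin.succ_castSucc], h2.2⟩

/-- The face map `∂_i : B_{p+1} G → B_p G`, which drops the `i`-th base point. -/
def face {p : ℕ} (i : Fin (p + 2)) (x : 𝒢.nerve (p + 1)) : 𝒢.nerve p :=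
  ⟨(fun j => x.1.1 (i.succAbove j), 𝒢.faceArrows i x.1.2), 𝒢.face_mem i x.2⟩

theorem face_face {p : ℕ} (i j : Fin (p + 2)) (hij : i ≤ j) (x : 𝒢.nerve (p + 2)) :
    𝒢.face i (𝒢.face j.succ x) = 𝒢.face j (𝒢.face i.castSucc x) := by
  obtain ⟨⟨m, g⟩, hx⟩ := x
  rw [Fin.le_def] at hij
  refine Subtype.ext (Prod.ext (funext fun k => ?_) (funext fun k => ?_))
  · simp only [face]
    congr 1
    ext
    simp only [Fin.succAbove, Fin.lt_def, Fin.val_castSucc, Fin.val_succ]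
    split_ifs <;> simp_all <;> omega
  · have c1 := hx k.castSucc.castSucc
    have c2 := hx k.castSucc.succ
    have c3 := hx k.succ.succ
    have e1 : 𝒢.source (g k.castSucc.castSucc) = 𝒢.target (g k.castSucc.succ) := by
      rw [c1.2, c2.1]; rfl
    have e2 : 𝒢.source (g k.castSucc.succ) = 𝒢.target (g k.succ.succ) := by
      rw [c2.2, c3.1]; rfl
    have ha := 𝒢.mul_assoc _ _ _ e1 e2
    simp only [face, faceArrows, Fin.val_castSucc, Fin.val_succ, Fin.succ_castSucc] at *
    split_ifs <;> first | rfl | omega | exact ha | exact ha.symm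

/-! ### The actions on the nerve -/

/-- The arrows of `(g₁, …, g_p) · a` for the `i`-th action: the arrow ending at the base point `m_i`
is multiplied by `a` on the right, and the arrow starting there by `a⁻¹` on the left. -/
def actArrows {p : ℕ} (i : Fin (p + 1)) (a : G) (g : Fin p → G) : Fin p → G := fun k =>
  if (k : ℕ) + 1 = i then 𝒢.mul (g k) a
  else if (k : ℕ) = i then 𝒢.mul (𝒢.inv a) (g k)
  else g k

theorem act_mem {p : ℕ} (i : Fin (p + 1)) (a : G) {x : (Fin (p + 1) → M) × (Fin p → G)}
    (hx : x ∈ 𝒢.nerve p) (ha : 𝒢.target a = x.1 i) :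
    ((Function.update x.1 i (𝒢.source a), 𝒢.actArrows i a x.2) :
      (Fin (p + 1) → M) × (Fin p → G)) ∈ 𝒢.nerve p := by
  intro k
  have h := hx k
  simp only [actArrows]
  split_ifs with h1 h2
  · have e : k.succ = i := Fin.ext (by simpa using h1)
    have e' : k.castSucc ≠ i := fun e' => by
      have := congrArg Fin.val e'
      simp only [Fin.val_castSucc] at this; omega
    have hc : 𝒢.source (x.2 k) = 𝒢.target a := by rw [h.2, e, ha]
    rw [𝒢.target_mul _ _ hc, 𝒢.source_mul _ _ hc, e, Function.update_self,
      Function.update_of_ne e']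
    exact ⟨h.1, rfl⟩
  · have e : k.castSucc = i := Fin.ext (by simpa using h2)
    have e' : k.succ ≠ i := fun e' => by
      have := congrArg Fin.val e'
      simp only [Fin.val_succ] at this; omega
    have hc : 𝒢.source (𝒢.inv a) = 𝒢.target (x.2 k) := by rw [𝒢.source_inv, h.1, e, ha]
    rw [𝒢.target_mul _ _ hc, 𝒢.source_mul _ _ hc, e, Function.update_self,
      Function.update_of_ne e', 𝒢.target_inv]
    exact ⟨rfl, h.2⟩
  · have e : k.castSucc ≠ i := fun e' => by
      have := congrArg Fin.val e'
      simp only [Fin.val_castSucc] at this; omega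
    have e' : k.succ ≠ i := fun e' => by
      have := congrArg Fin.val e'
      simp only [Fin.val_succ] at this; omega
    rw [Function.update_of_ne e, Function.update_of_ne e']
    exact h

/-- The `i`-th right action of `G` on `B_p G`, defined for `a` with target `m_i`; the base point
`m_i` is replaced by the source of `a`. -/
def act {p : ℕ} (i : Fin (p + 1)) (a : G) (x : 𝒢.nerve p) (ha : 𝒢.target a = x.1.1 i) :
    𝒢.nerve p :=
  ⟨(Function.update x.1.1 i (𝒢.source a), 𝒢.actArrows i a x.1.2), 𝒢.act_mem i a x.2 ha⟩

/-! ### Cochains -/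

/-- The manifold structure (model with corners) of `M^{p+1} × G^p`, in which `B_p G` is embedded. -/
noncomputable abbrev nerveModel (_ : LieGroupoid EG EM G M) (p : ℕ) :
    ModelWithCorners ℝ ((Fin (p + 1) → EM) × (Fin p → EG))
      (ModelProd (ModelPi fun _ : Fin (p + 1) => EM) (ModelPi fun _ : Fin p => EG)) :=
  (ModelWithCorners.pi fun _ : Fin (p + 1) => 𝓘(ℝ, EM)).prod
    (ModelWithCorners.pi fun _ : Fin p => 𝓘(ℝ, EG))

/-- Smooth real functions on the embedded submanifold `B_p G` of `M^{p+1} × G^p`, i.e. elements of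
`C^p(G) = C^∞(B_p G)`.  (For a function on an embedded submanifold, being smooth for the submanifold
structure is the same as being `ContMDiffOn` as a function on that subset of the ambient manifold;
the values of `F` outside `B_p G` do not matter.) -/
def IsSmoothCochain {p : ℕ} (f : 𝒢.nerve p → ℝ) : Prop :=
  ∃ F : (Fin (p + 1) → M) × (Fin p → G) → ℝ,
    ContMDiffOn (𝒢.nerveModel p) 𝓘(ℝ, ℝ) ∞ F (𝒢.nerve p) ∧ ∀ x : 𝒢.nerve p, F x = f x

/-- `f` is invariant under the arrows in `A` for each of the `p + 1` actions on `B_p G`. -/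
def IsInvariantCochain (A : Set G) {p : ℕ} (f : 𝒢.nerve p → ℝ) : Prop :=
  ∀ (i : Fin (p + 1)) (a : G), a ∈ A → ∀ (x : 𝒢.nerve p) (ha : 𝒢.target a = x.1.1 i),
    f (𝒢.act i a x ha) = f x

/-- `f` vanishes on each `p`-arrow `(g₁, …, g_p)` with some `g_i` in `A`. -/
def IsNormalizedCochain (A : Set G) {p : ℕ} (f : 𝒢.nerve p → ℝ) : Prop :=
  ∀ (x : 𝒢.nerve p) (i : Fin p), x.1.2 i ∈ A → f x = 0

/-- `C^p(G)^A`: the smooth functions on `B_p G` invariant under `A` for each of the actions. -/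
def invariantCochains (A : Set G) (p : ℕ) : Submodule ℝ (𝒢.nerve p → ℝ) where
  carrier := {f | 𝒢.IsSmoothCochain f ∧ 𝒢.IsInvariantCochain A f}
  zero_mem' := ⟨⟨0, contMDiffOn_const, fun _ => rfl⟩, fun _ _ _ _ _ => rfl⟩
  add_mem' := by
    rintro f f' ⟨⟨F, hF, hf⟩, hi⟩ ⟨⟨F', hF', hf'⟩, hi'⟩
    exact ⟨⟨F + F', hF.add hF', fun x => by simp [hf, hf']⟩,
      fun i a haA x ha => by simp [hi i a haA x ha, hi' i a haA x ha]⟩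
  smul_mem' := by
    rintro c f ⟨⟨F, hF, hf⟩, hi⟩
    exact ⟨⟨fun x => c * F x, contMDiffOn_const.mul hF, fun x => by simp [hf]⟩,
      fun i a haA x ha => by simp [hi i a haA x ha]⟩

/-- The normalized cochains in `C^p(G)^A`. -/
def normalizedInvariantCochains (A : Set G) (p : ℕ) : Submodule ℝ (𝒢.nerve p → ℝ) where
  carrier := {f | f ∈ 𝒢.invariantCochains A p ∧ 𝒢.IsNormalizedCochain A f}
  zero_mem' := ⟨Submodule.zero_mem _, fun _ _ _ => rfl⟩
  add_mem' := fun hf hf' => ⟨Submodule.add_mem _ hf.1 hf'.1,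
    fun x i hi => by simp [hf.2 x i hi, hf'.2 x i hi]⟩
  smul_mem' := fun c _ hf => ⟨Submodule.smul_mem _ c hf.1, fun x i hi => by simp [hf.2 x i hi]⟩

theorem normalizedInvariantCochains_le (A : Set G) (p : ℕ) :
    𝒢.normalizedInvariantCochains A p ≤ 𝒢.invariantCochains A p := fun _ hf => hf.1

/-- The differential `δ = ∑_{i=0}^{p+1} (-1)^i ∂_i^*`. -/
def coboundary (p : ℕ) : (𝒢.nerve p → ℝ) →ₗ[ℝ] (𝒢.nerve (p + 1) → ℝ) where
  toFun f := fun x => ∑ i : Fin (p + 2), (-1 : ℝ) ^ (i : ℕ) * f (𝒢.face i x)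
  map_add' f f' := by
    funext x
    simp [mul_add, Finset.sum_add_distrib]
  map_smul' c f := by
    funext x
    simp only [Pi.smul_apply, smul_eq_mul, RingHom.id_apply, Finset.mul_sum]
    exact Finset.sum_congr rfl fun i _ => by ring

theorem coboundary_apply (p : ℕ) (f : 𝒢.nerve p → ℝ) (x : 𝒢.nerve (p + 1)) :
    𝒢.coboundary p f x = ∑ i : Fin (p + 2), (-1 : ℝ) ^ (i : ℕ) * f (𝒢.face i x) := rfl

theorem coboundary_coboundary (p : ℕ) (f : 𝒢.nerve p → ℝ) :
    𝒢.coboundary (p + 1) (𝒢.coboundary p f) = 0 := by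
  funext x
  simp only [coboundary_apply, Finset.mul_sum, Pi.zero_apply, ← Finset.sum_product']
  let P := Fin (p + 3) × Fin (p + 2)
  let S : Finset P := {ij : P | (ij.1 : ℕ) ≤ (ij.2 : ℕ)}
  rw [Finset.univ_product_univ, ← Finset.sum_add_sum_compl S, ← eq_neg_iff_add_eq_zero,
    ← Finset.sum_neg_distrib]
  refine Finset.sum_bij (fun ij hij => (ij.2.succ, Fin.castLT ij.1
    (lt_of_le_of_lt (Finset.mem_filter.mp hij).right (Fin.is_lt ij.2)))) ?_ ?_ ?_ ?_
  · intro ij hij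
    simp_rw [S, Finset.compl_filter, Finset.mem_filter_univ, Fin.val_succ, Fin.val_castLT] at hij ⊢
    omega
  · rintro ⟨i, j⟩ hij ⟨i', j'⟩ hij' h
    have h1 := congrArg (fun q => (q.1 : ℕ)) h
    have h2 := congrArg (fun q => (q.2 : ℕ)) h
    simp only [Fin.val_succ, Fin.val_castLT] at h1 h2
    exact Prod.ext (Fin.ext h2) (Fin.ext (Nat.succ_injective h1))
  · rintro ⟨j, i⟩ hij
    simp_rw [S, Finset.compl_filter, Finset.mem_filter_univ, not_le] at hij
    refine ⟨(i.castSucc, j.pred (by rintro rfl; simp at hij)), ?_, ?_⟩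
    · simp only [S, Finset.mem_filter_univ, Fin.val_castSucc, Fin.val_pred]
      omega
    · simp
  · rintro ⟨i, j⟩ hij
    have hij' : (i : ℕ) ≤ j := by simpa [S] using hij
    have hlt : (i : ℕ) < p + 2 := lt_of_le_of_lt hij' j.2
    have e := 𝒢.face_face (Fin.castLT i hlt) j (by simpa [Fin.le_def] using hij') x
    rw [Fin.castSucc_castLT] at e
    simp only [Fin.val_succ, Fin.val_castLT, e, pow_succ]
    ring

theorem coboundary_isSmooth {p : ℕ} {f : 𝒢.nerve p → ℝ} (hf : 𝒢.IsSmoothCochain f) :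
    𝒢.IsSmoothCochain (𝒢.coboundary p f) := by
  obtain ⟨F, hF, hFf⟩ := hf
  have hfst : ∀ j, ContMDiff (𝒢.nerveModel (p + 1)) 𝓘(ℝ, EM) ∞
      (fun x : (Fin (p + 2) → M) × (Fin (p + 1) → G) => x.1 j) := fun j =>
    (contMDiff_powerManifold_apply j).comp contMDiff_fst
  have hsnd : ∀ j, ContMDiff (𝒢.nerveModel (p + 1)) 𝓘(ℝ, EG) ∞
      (fun x : (Fin (p + 2) → M) × (Fin (p + 1) → G) => x.2 j) := fun j =>
    (contMDiff_powerManifold_apply j).comp contMDiff_snd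
  have hface : ∀ i : Fin (p + 2), ContMDiffOn (𝒢.nerveModel (p + 1)) (𝒢.nerveModel p) ∞
      (fun x : (Fin (p + 2) → M) × (Fin (p + 1) → G) =>
        ((fun j => x.1 (i.succAbove j), 𝒢.faceArrows i x.2) : (Fin (p + 1) → M) × (Fin p → G)))
      (𝒢.nerve (p + 1)) := by
    intro i
    refine ContMDiffOn.prodMk (contMDiffOn_powerManifold fun j => (hfst _).contMDiffOn)
      (contMDiffOn_powerManifold fun k => ?_)
    simp only [faceArrows]
    split_ifs
    · exact (hsnd _).contMDiffOn
    · refine 𝒢.contMDiffOn_mul.comp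
        ((hsnd k.castSucc).contMDiffOn.prodMk (hsnd k.succ).contMDiffOn) fun x hx => ?_
      have h1 := hx k.castSucc
      have h2 := hx k.succ
      change 𝒢.source (x.2 k.castSucc) = 𝒢.target (x.2 k.succ)
      rw [h1.2, h2.1, Fin.succ_castSucc]
    · exact (hsnd _).contMDiffOn
  refine ⟨fun x => ∑ i : Fin (p + 2), (-1 : ℝ) ^ (i : ℕ) *
    F (fun j => x.1 (i.succAbove j), 𝒢.faceArrows i x.2), ?_, fun x => ?_⟩
  · refine contMDiffOn_finsetSum fun i _ => contMDiffOn_const.mul ?_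
    exact hF.comp (hface i) fun x hx => 𝒢.face_mem i hx
  · exact Finset.sum_congr rfl fun i _ => by rw [← hFf]; rfl

/-- Dropping a base point other than the one acted upon commutes with the action. -/
theorem face_act_of_ne {p : ℕ} (i : Fin (p + 2)) (l : Fin (p + 1)) (a : G) (x : 𝒢.nerve (p + 1))
    (ha : 𝒢.target a = x.1.1 (i.succAbove l)) :
    𝒢.face i (𝒢.act (i.succAbove l) a x ha) = 𝒢.act l a (𝒢.face i x) ha := by
  obtain ⟨⟨m, g⟩, hx⟩ := x
  refine Subtype.ext (Prod.ext (funext fun k => ?_) (funext fun k => ?_))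
  · simp only [face, act, Function.update_apply, Fin.succAbove_right_inj]
  · have c1 := hx k.castSucc
    have c2 := hx k.succ
    have c : 𝒢.source (g k.castSucc) = 𝒢.target (g k.succ) := by
      rw [c1.2, c2.1, Fin.succ_castSucc]
    have ha' : 𝒢.target a = m (i.succAbove l) := ha
    have hv : ((i.succAbove l : Fin (p + 2)) : ℕ) = if (l : ℕ) < i then (l : ℕ) else l + 1 := by
      simp only [Fin.succAbove, Fin.lt_def, Fin.val_castSucc]
      split_ifs <;> simp
    -- the arrow after which, or before which, `a` is inserted
    have hr : (k : ℕ) + 2 = (i.succAbove l : Fin (p + 2)) → 𝒢.source (g k.succ) = 𝒢.target a := by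
      intro e
      rw [c2.2, ha']
      exact congrArg m (Fin.ext (by simpa using e))
    have hl : (k : ℕ) = (i.succAbove l : Fin (p + 2)) →
        𝒢.source (𝒢.inv a) = 𝒢.target (g k.castSucc) := by
      intro e
      rw [𝒢.source_inv, c1.1, ha']
      exact congrArg m (Fin.ext (by simpa using e.symm))
    have Hr : (k : ℕ) + 2 = (i.succAbove l : Fin (p + 2)) →
        𝒢.mul (g k.castSucc) (𝒢.mul (g k.succ) a) =
          𝒢.mul (𝒢.mul (g k.castSucc) (g k.succ)) a :=
      fun e => (𝒢.mul_assoc _ _ _ c (hr e)).symm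
    have Hl : (k : ℕ) = (i.succAbove l : Fin (p + 2)) →
        𝒢.mul (𝒢.mul (𝒢.inv a) (g k.castSucc)) (g k.succ) =
          𝒢.mul (𝒢.inv a) (𝒢.mul (g k.castSucc) (g k.succ)) :=
      fun e => 𝒢.mul_assoc _ _ _ (hl e) c
    rw [hv] at Hr Hl
    simp only [face, act, faceArrows, actArrows, Fin.val_castSucc, Fin.val_succ, hv]
    split_ifs at * <;> first | rfl | omega | exact Hr (by omega) | exact Hl (by omega)

/-- Dropping the base point acted upon undoes the action. -/
theorem face_act_self {p : ℕ} (i : Fin (p + 2)) (a : G) (x : 𝒢.nerve (p + 1))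
    (ha : 𝒢.target a = x.1.1 i) :
    𝒢.face i (𝒢.act i a x ha) = 𝒢.face i x := by
  obtain ⟨⟨m, g⟩, hx⟩ := x
  refine Subtype.ext (Prod.ext (funext fun k => ?_) (funext fun k => ?_))
  · simp only [face, act, Function.update_apply, Fin.succAbove_ne, if_false]
  · have c1 := hx k.castSucc
    have c2 := hx k.succ
    have c : 𝒢.source (g k.castSucc) = 𝒢.target (g k.succ) := by
      rw [c1.2, c2.1, Fin.succ_castSucc]
    have ha' : 𝒢.target a = m i := ha
    have H : (k : ℕ) + 1 = i → 𝒢.mul (𝒢.mul (g k.castSucc) a) (𝒢.mul (𝒢.inv a) (g k.succ)) =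
        𝒢.mul (g k.castSucc) (g k.succ) := by
      intro e
      have e1 : 𝒢.source (g k.castSucc) = 𝒢.target a := by
        rw [c1.2, ha']
        exact congrArg m (Fin.ext (by simpa using e))
      have e2 : 𝒢.source (𝒢.inv a) = 𝒢.target (g k.succ) := by rw [𝒢.source_inv, ← c, e1]
      rw [𝒢.mul_assoc _ _ _ e1 (by rw [𝒢.target_mul _ _ e2, 𝒢.target_inv]),
        ← 𝒢.mul_assoc _ _ _ (𝒢.target_inv a).symm e2, 𝒢.mul_inv,
        show 𝒢.target a = 𝒢.target (g k.succ) by rw [← c, e1], 𝒢.unit_mul]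
    simp only [face, act, faceArrows, actArrows, Fin.val_castSucc, Fin.val_succ]
    split_ifs <;> first | rfl | omega | exact H (by omega)

theorem coboundary_isInvariant (A : Set G) {p : ℕ} {f : 𝒢.nerve p → ℝ}
    (hf : 𝒢.IsInvariantCochain A f) : 𝒢.IsInvariantCochain A (𝒢.coboundary p f) := by
  intro l a haA x ha
  rw [coboundary_apply, coboundary_apply]
  refine Finset.sum_congr rfl fun i _ => ?_
  congr 1
  rcases eq_or_ne l i with rfl | h
  · rw [face_act_self]
  · obtain ⟨l', rfl⟩ := Fin.exists_succAbove_eq h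
    rw [face_act_of_ne]
    exact hf l' a haA (𝒢.face i x) ha

/-- The two faces dropping an end point of the arrow `g_j` differ by the action of `g_j`. -/
theorem face_castSucc_eq_act {p : ℕ} (x : 𝒢.nerve (p + 1)) (j : Fin (p + 1)) :
    𝒢.act j (x.1.2 j) (𝒢.face j.succ x) (by simp [face, (x.2 j).1]) = 𝒢.face j.castSucc x := by
  obtain ⟨⟨m, g⟩, hx⟩ := x
  refine Subtype.ext (Prod.ext (funext fun k => ?_) (funext fun k => ?_))
  · simp only [face, act, Function.update_apply]
    split_ifs with h
    · subst h
      rw [(hx k).2, Fin.succAbove_castSucc_self]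
    · congr 1
      rw [Fin.ext_iff] at h
      ext
      simp only [Fin.succAbove, Fin.lt_def, Fin.val_castSucc, Fin.val_succ]
      split_ifs <;> simp_all <;> omega
  · have c1 := hx k.castSucc
    have c2 := hx k.succ
    have c : 𝒢.source (g k.castSucc) = 𝒢.target (g k.succ) := by
      rw [c1.2, c2.1, Fin.succ_castSucc]
    have e1 : (k : ℕ) + 1 = j → g j = g k.succ := fun e =>
      congrArg g (Fin.ext (by simp [← e]))
    have e2 : (k : ℕ) = j → g j = g k.castSucc := fun e =>
      congrArg g (Fin.ext (by simp [← e]))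
    have H : (k : ℕ) = j → 𝒢.mul (𝒢.inv (g j)) (𝒢.mul (g k.castSucc) (g k.succ)) =
        g k.succ := by
      intro e
      rw [e2 e, ← 𝒢.mul_assoc _ _ _ (𝒢.source_inv _) c, 𝒢.inv_mul, c, 𝒢.unit_mul]
    have H1 : (k : ℕ) + 1 = j → 𝒢.mul (g k.castSucc) (g j) =
        𝒢.mul (g k.castSucc) (g k.succ) := fun e => by rw [e1 e]
    simp only [face, act, faceArrows, actArrows, Fin.val_castSucc, Fin.val_succ]
    split_ifs <;> first | rfl | omega | exact H (by omega) | exact H1 (by omega)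

theorem coboundary_isNormalized (A : Set G) {p : ℕ} {f : 𝒢.nerve p → ℝ}
    (hf : 𝒢.IsInvariantCochain A f) (hn : 𝒢.IsNormalizedCochain A f) :
    𝒢.IsNormalizedCochain A (𝒢.coboundary p f) := by
  intro x j hj
  rw [coboundary_apply, Fintype.sum_eq_add j.castSucc j.succ (Fin.castSucc_lt_succ).ne]
  · rw [← 𝒢.face_castSucc_eq_act x j, hf j _ hj]
    simp [pow_succ]
  · rintro i ⟨h1, h2⟩
    rw [ne_eq, Fin.ext_iff, Fin.val_castSucc] at h1
    rw [ne_eq, Fin.ext_iff, Fin.val_succ] at h2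
    refine mul_eq_zero_of_right _ ?_
    rcases lt_or_gt_of_ne h1 with h | h
    · have hj0 : 0 < (j : ℕ) := by omega
      refine hn _ ⟨(j : ℕ) - 1, by omega⟩ ?_
      have e : (⟨(j : ℕ) - 1, by omega⟩ : Fin p).succ = j := Fin.ext (by simp; omega)
      simp only [face, faceArrows, e]
      rw [if_neg (by omega), if_neg (by omega)]
      exact hj
    · refine hn _ ⟨(j : ℕ), by omega⟩ ?_
      simp only [face, faceArrows]
      rw [if_pos (by omega)]
      exact hj

theorem coboundary_mem_invariant (A : Set G) (p : ℕ) :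
    ∀ f ∈ 𝒢.invariantCochains A p, 𝒢.coboundary p f ∈ 𝒢.invariantCochains A (p + 1) :=
  fun _ hf => ⟨𝒢.coboundary_isSmooth hf.1, 𝒢.coboundary_isInvariant A hf.2⟩

theorem coboundary_mem_normalizedInvariant (A : Set G) (p : ℕ) :
    ∀ f ∈ 𝒢.normalizedInvariantCochains A p,
      𝒢.coboundary p f ∈ 𝒢.normalizedInvariantCochains A (p + 1) :=
  fun f hf => ⟨𝒢.coboundary_mem_invariant A p f hf.1,
    𝒢.coboundary_isNormalized A hf.1.2 hf.2⟩

/-! ### The complexes and the inclusion -/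

/-- The cochain complex, with differential `δ`, given by subspaces of the spaces of functions on
`B_p G` that are preserved by `δ`. -/
noncomputable def subcomplex (S : ∀ p, Submodule ℝ (𝒢.nerve p → ℝ))
    (hS : ∀ p, ∀ f ∈ S p, 𝒢.coboundary p f ∈ S (p + 1)) : CochainComplex (ModuleCat ℝ) ℕ :=
  CochainComplex.of (fun p => ModuleCat.of ℝ (S p))
    (fun p => ModuleCat.ofHom ((𝒢.coboundary p).restrict (hS p)))
    (fun p => by
      ext f
      exact congrFun (𝒢.coboundary_coboundary p f.1) _)

theorem subcomplex_d (S : ∀ p, Submodule ℝ (𝒢.nerve p → ℝ))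
    (hS : ∀ p, ∀ f ∈ S p, 𝒢.coboundary p f ∈ S (p + 1)) (p : ℕ) :
    (𝒢.subcomplex S hS).d p (p + 1) =
      ModuleCat.ofHom ((𝒢.coboundary p).restrict (hS p)) :=
  CochainComplex.of_d (fun p => ModuleCat.of ℝ (S p))
    (fun p => ModuleCat.ofHom ((𝒢.coboundary p).restrict (hS p))) p

/-- The `K`-invariant complex `C(G)^K`, for `A` the set of arrows of `K`. -/
noncomputable def invariantComplex (A : Set G) : CochainComplex (ModuleCat ℝ) ℕ :=
  𝒢.subcomplex (𝒢.invariantCochains A) (𝒢.coboundary_mem_invariant A)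

/-- The normalized `K`-invariant complex, for `A` the set of arrows of `K`. -/
noncomputable def normalizedInvariantComplex (A : Set G) : CochainComplex (ModuleCat ℝ) ℕ :=
  𝒢.subcomplex (𝒢.normalizedInvariantCochains A) (𝒢.coboundary_mem_normalizedInvariant A)

/-- The inclusion of the normalized `K`-invariant complex in the `K`-invariant complex. -/
noncomputable def normalizedInclusion (A : Set G) :
    𝒢.normalizedInvariantComplex A ⟶ 𝒢.invariantComplex A :=
  CochainComplex.ofHom
    (fun p => ModuleCat.ofHom (Submodule.inclusion (𝒢.normalizedInvariantCochains_le A p)))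
    (fun p => by
      simp only [normalizedInvariantComplex, invariantComplex, subcomplex_d]
      rfl)

end LieGroupoid

end Groupoid

/-!
The cochains invariant under `K` form a cosimplicial vector space. Each face map pulls invariant
cochains back to invariant ones (`isInvariantCochain_comp_face`). So does each degeneracy, which
repeats a base point `m_j` by inserting a unit arrow: acting at `m_j` before the degeneracy is acting
at both copies of `m_j` after it (`degen_act_self`, `isInvariantCochain_comp_degen`).

If an arrow `g_j` of `(g_1, …, g_p)` lies in `K`, then the action of `g_j` at its target turns `g_j`
into a unit, so that the `p`-arrow becomes a degenerate one (`act_eq_degen_face`). Therefore an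
invariant cochain vanishes on all `p`-arrows having an arrow in `K` if and only if it is killed by all
codegeneracies (`isNormalizedCochain_iff`), and the normalized invariant complex is the usual
normalized complex of a cosimplicial vector space.

It remains to show that normalized cochains are a deformation retract, for any cosimplicial module
(`CosimplicialModule`). Let `t_q = (-1)^q s_q` be the signed `q`-th codegeneracy. The cochain map
`1 - (δ t_q + t_q δ)` sends cochains killed by `s_0, …, s_{q-1}` to cochains killed by
`s_0, …, s_q`, and fixes the latter (`codegen_reduce`, `reduce_eq_self`). In degree `p` the
cochains killed by `s_0, …, s_{p-1}` are normalized already, so that the composites over `q` stabilize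
to a projection onto the normalized cochains, and the homotopies add up (`diff_normalizeHomotopy_add`).
-/

/-! ### Normalization of cosimplicial modules -/

section Normalization

/-- A cosimplicial module, given by its cofaces and codegeneracies. The indices are natural numbers;
`coface p i` matters only for `i ≤ p + 1`, and `codegen p j`, meaningful for `j ≤ p`, is zero
otherwise. Of the relation between cofaces only its consequence, that the alternating sum of the
cofaces is a differential, is recorded. -/
structure CosimplicialModule (R : Type*) [CommRing R] (C : ℕ → Type*)
    [∀ p, AddCommGroup (C p)] [∀ p, Module R (C p)] where
  coface (p i : ℕ) : C p →ₗ[R] C (p + 1)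
  codegen (p j : ℕ) : C (p + 1) →ₗ[R] C p
  codegen_eq_zero : ∀ p j, p < j → codegen p j = 0
  codegen_coface_of_lt : ∀ p i j, i ≤ j → j ≤ p → ∀ f,
    codegen (p + 1) (j + 1) (coface (p + 1) i f) = coface p i (codegen p j f)
  codegen_coface_self : ∀ p j, j ≤ p → ∀ f, codegen p j (coface p j f) = f
  codegen_coface_succ : ∀ p j, j ≤ p → ∀ f, codegen p j (coface p (j + 1) f) = f
  codegen_coface_of_gt : ∀ p i j, j < i → i ≤ p + 1 → ∀ f,
    codegen (p + 1) j (coface (p + 1) (i + 1) f) = coface p i (codegen p j f)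
  codegen_codegen : ∀ p i j, i ≤ j → ∀ f,
    codegen p j (codegen (p + 1) i f) = codegen p i (codegen (p + 1) (j + 1) f)
  sum_coface_sum_coface : ∀ p f,
    ∑ i ∈ Finset.range (p + 3), (-1 : R) ^ i •
      coface (p + 1) i (∑ j ∈ Finset.range (p + 2), (-1 : R) ^ j • coface p j f) = 0

namespace CosimplicialModule

variable {R : Type*} [CommRing R] {C : ℕ → Type*}
    [∀ p, AddCommGroup (C p)] [∀ p, Module R (C p)] (X : CosimplicialModule R C)

/-- The differential: the alternating sum of the cofaces. -/
def diff (p : ℕ) : C p →ₗ[R] C (p + 1) :=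
  ∑ i ∈ Finset.range (p + 2), (-1 : R) ^ i • X.coface p i

theorem diff_apply (p : ℕ) (f : C p) :
    X.diff p f = ∑ i ∈ Finset.range (p + 2), (-1 : R) ^ i • X.coface p i f := by
  simp [diff]

theorem diff_diff (p : ℕ) (f : C p) : X.diff (p + 1) (X.diff p f) = 0 := by
  rw [diff_apply, diff_apply, X.sum_coface_sum_coface]

/-- The signed `q`-th codegeneracy, viewed as a map of degree `-1` on the cochain complex. -/
def signedCodegen (q p : ℕ) : C (p + 1) →ₗ[R] C p := (-1 : R) ^ q • X.codegen p q

theorem signedCodegen_apply (q p : ℕ) (f : C (p + 1)) :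
    X.signedCodegen q p f = (-1 : R) ^ q • X.codegen p q f := rfl

/-- The cochain map `1 - (δ t + t δ)`, homotopic to the identity through the signed `q`-th
codegeneracy `t`. -/
def reduce (q : ℕ) : ∀ p, C p →ₗ[R] C p
  | 0 => LinearMap.id - X.signedCodegen q 0 ∘ₗ X.diff 0
  | p + 1 => LinearMap.id -
      (X.diff p ∘ₗ X.signedCodegen q p + X.signedCodegen q (p + 1) ∘ₗ X.diff (p + 1))

theorem reduce_zero_apply (q : ℕ) (f : C 0) :
    X.reduce q 0 f = f - X.signedCodegen q 0 (X.diff 0 f) := rfl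

theorem reduce_succ_apply (q p : ℕ) (f : C (p + 1)) :
    X.reduce q (p + 1) f =
      f - (X.diff p (X.signedCodegen q p f) + X.signedCodegen q (p + 1) (X.diff (p + 1) f)) := rfl

theorem diff_reduce (q p : ℕ) (f : C p) :
    X.diff p (X.reduce q p f) = X.reduce q (p + 1) (X.diff p f) := by
  cases p with
  | zero => rw [reduce_zero_apply, reduce_succ_apply, X.diff_diff]; simp
  | succ p => rw [reduce_succ_apply, reduce_succ_apply, X.diff_diff]; simp [X.diff_diff]

/-- In degree `0` there is nothing to normalize. -/
theorem reduce_zero (q : ℕ) (f : C 0) : X.reduce q 0 f = f := by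
  rw [reduce_zero_apply, signedCodegen_apply, diff_apply]
  rcases Nat.eq_zero_or_pos q with rfl | hq
  · simp [Finset.sum_range_succ, X.codegen_coface_self 0 0 le_rfl,
      X.codegen_coface_succ 0 0 le_rfl]
  · simp [X.codegen_eq_zero 0 q hq]

/-- The telescoping cancellation behind `reduce_eq_of_codegen_eq_zero`. -/
theorem sum_range_succ_add_sum_range {A : Type*} [AddCommGroup A] (u v : ℕ → A) (q n : ℕ)
    (hqn : q + 1 ≤ n) (h0 : ∀ i < q, u i = 0) (h1 : u (q + 1) = -u q)
    (h2 : ∀ i, q < i → i < n → u (i + 1) = -v i) :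
    ∑ i ∈ Finset.range n, v i + ∑ i ∈ Finset.range (n + 1), u i =
      ∑ i ∈ Finset.range (q + 1), v i := by
  induction n, hqn using Nat.le_induction with
  | base =>
    rw [Finset.sum_range_succ u, Finset.sum_range_succ u,
      Finset.sum_eq_zero fun i hi => h0 i (Finset.mem_range.1 hi), h1]
    simp
  | succ n hn ih =>
    rw [Finset.sum_range_succ u, Finset.sum_range_succ v, h2 n (by omega) (by omega),
      ← ih fun i hi hi' => h2 i hi (by omega)]
    abel

/-- On cochains killed by the codegeneracies below `q`, all terms of `δ t + t δ` that do not
involve the first `q + 1` cofaces cancel. -/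
theorem reduce_eq_of_codegen_eq_zero (q p : ℕ) (f : C (p + 1))
    (hf : ∀ j < q, X.codegen p j f = 0) :
    X.reduce q (p + 1) f = f - (-1 : R) ^ q •
      ∑ i ∈ Finset.range (q + 1), (-1 : R) ^ i • X.coface p i (X.codegen p q f) := by
  rw [reduce_succ_apply, signedCodegen_apply, signedCodegen_apply, map_smul, ← smul_add]
  congr 2
  rw [diff_apply, diff_apply, map_sum]
  simp only [map_smul]
  rcases Nat.lt_or_ge (p + 1) q with hq | hq
  · simp [X.codegen_eq_zero p q (by omega), X.codegen_eq_zero (p + 1) q hq]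
  · refine sum_range_succ_add_sum_range _
      (fun i => (-1 : R) ^ i • X.coface p i (X.codegen p q f)) q (p + 2) (by omega) ?_ ?_ ?_
    · intro i hi
      obtain ⟨q, rfl⟩ : ∃ r, q = r + 1 := ⟨q - 1, by omega⟩
      rw [X.codegen_coface_of_lt p i q (by omega) (by omega), hf q (by omega), map_zero, smul_zero]
    · rw [X.codegen_coface_self _ _ hq, X.codegen_coface_succ _ _ hq, pow_succ]
      simp
    · intro i hi hi'
      rw [X.codegen_coface_of_gt p i q hi (by omega), pow_succ]
      simp

/-- Reducing with respect to `q` normalizes one further codegeneracy. -/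
theorem codegen_reduce (q p : ℕ) (f : C (p + 1)) (hf : ∀ j < q, X.codegen p j f = 0) :
    ∀ j < q + 1, X.codegen p j (X.reduce q (p + 1) f) = 0 := by
  intro j hj
  rw [X.reduce_eq_of_codegen_eq_zero q p f hf, map_sub, map_smul, map_sum]
  simp only [map_smul]
  rcases Nat.lt_or_ge p q with hq | hq
  · rcases Nat.lt_succ_iff_lt_or_eq.1 hj with h | rfl
    · simp [X.codegen_eq_zero p q hq, hf j h]
    · simp [X.codegen_eq_zero p j hq]
  cases p with
  | zero =>
    obtain rfl : q = 0 := by omega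
    obtain rfl : j = 0 := by omega
    simp [X.codegen_coface_self 0 0 le_rfl]
  | succ p =>
    have hzero : ∀ i < q, X.codegen p i (X.codegen (p + 1) q f) = 0 := fun i hi => by
      obtain ⟨q, rfl⟩ : ∃ r, q = r + 1 := ⟨q - 1, by omega⟩
      rw [← X.codegen_codegen p i q (by omega), hf i hi, map_zero]
    have hlow : ∀ i < j, (-1 : R) ^ i •
        X.codegen (p + 1) j (X.coface (p + 1) i (X.codegen (p + 1) q f)) = 0 := fun i hi => by
      obtain ⟨j, rfl⟩ : ∃ r, j = r + 1 := ⟨j - 1, by omega⟩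
      rw [X.codegen_coface_of_lt p i j (by omega) (by omega), hzero j (by omega), map_zero,
        smul_zero]
    rcases Nat.lt_succ_iff_lt_or_eq.1 hj with h | rfl
    -- For `j < q` the terms `i = j` and `i = j + 1` cancel, and the others vanish.
    · rw [hf j h, zero_sub, neg_eq_zero]
      refine smul_eq_zero_of_right _ ?_
      have := sum_range_succ_add_sum_range (fun i => (-1 : R) ^ i •
        X.codegen (p + 1) j (X.coface (p + 1) i (X.codegen (p + 1) q f))) 0 j q h hlow ?_ ?_
      · simpa using this
      · rw [X.codegen_coface_self _ _ (by omega), X.codegen_coface_succ _ _ (by omega), pow_succ]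
        simp
      · intro i hi hi'
        rw [X.codegen_coface_of_gt p i j hi (by omega), hzero j h]
        simp
    -- For `j = q` only the term `i = q` survives, and it cancels `s_q f`.
    · rw [Finset.sum_range_succ, Finset.sum_eq_zero fun i hi => hlow i (Finset.mem_range.1 hi),
        X.codegen_coface_self _ _ hq, zero_add, smul_smul, ← mul_pow]
      simp

theorem reduce_eq_self (q p : ℕ) (f : C (p + 1)) (hf : ∀ j < q + 1, X.codegen p j f = 0) :
    X.reduce q (p + 1) f = f := by
  rw [X.reduce_eq_of_codegen_eq_zero q p f fun j hj => hf j (by omega), hf q (by omega)]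
  simp

/-- The composite of the first `q` reductions. -/
def iterReduce : ∀ _q p : ℕ, C p →ₗ[R] C p
  | 0, _ => LinearMap.id
  | q + 1, p => X.reduce q p ∘ₗ iterReduce q p

theorem iterReduce_succ_apply (q p : ℕ) (f : C p) :
    X.iterReduce (q + 1) p f = X.reduce q p (X.iterReduce q p f) := rfl

theorem diff_iterReduce (q p : ℕ) (f : C p) :
    X.diff p (X.iterReduce q p f) = X.iterReduce q (p + 1) (X.diff p f) := by
  induction q with
  | zero => rfl
  | succ q ih => rw [iterReduce_succ_apply, iterReduce_succ_apply, X.diff_reduce, ih]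

theorem codegen_iterReduce (q p : ℕ) (f : C (p + 1)) :
    ∀ j < q, X.codegen p j (X.iterReduce q (p + 1) f) = 0 := by
  induction q with
  | zero => intro j hj; omega
  | succ q ih => exact X.codegen_reduce q p _ ih

/-- In a fixed degree, the iterated reductions stabilize. -/
theorem iterReduce_of_le (q p : ℕ) (hpq : p ≤ q) (f : C p) :
    X.iterReduce q p f = X.iterReduce p p f := by
  induction q, hpq using Nat.le_induction with
  | base => rfl
  | succ q hq ih =>
    rw [iterReduce_succ_apply, ← ih]
    cases p with
    | zero => exact X.reduce_zero q _
    | succ p =>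
      refine X.reduce_eq_self q p _ fun j hj => ?_
      rcases Nat.lt_succ_iff_lt_or_eq.1 hj with h | rfl
      · exact X.codegen_iterReduce q p f j h
      · simp [X.codegen_eq_zero p j (by omega)]

/-- The sum of the homotopies between the successive iterated reductions. -/
def iterHomotopy : ∀ _q p : ℕ, C (p + 1) →ₗ[R] C p
  | 0, _ => 0
  | q + 1, p => iterHomotopy q p + X.signedCodegen q p ∘ₗ X.iterReduce q (p + 1)

theorem iterHomotopy_succ_apply (q p : ℕ) (f : C (p + 1)) :
    X.iterHomotopy (q + 1) p f =
      X.iterHomotopy q p f + X.signedCodegen q p (X.iterReduce q (p + 1) f) := rfl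

theorem iterHomotopy_of_le (q p : ℕ) (hpq : p + 1 ≤ q) (f : C (p + 1)) :
    X.iterHomotopy q p f = X.iterHomotopy (p + 1) p f := by
  induction q, hpq using Nat.le_induction with
  | base => rfl
  | succ q hq ih =>
    rw [iterHomotopy_succ_apply, ih, signedCodegen_apply, X.codegen_eq_zero p q (by omega)]
    simp

theorem iterReduce_zero (q : ℕ) (f : C 0) : X.iterReduce q 0 f = f := by
  rw [X.iterReduce_of_le q 0 (Nat.zero_le q)]
  rfl

theorem diff_iterHomotopy_add (q p : ℕ) (f : C (p + 1)) :
    X.diff p (X.iterHomotopy q p f) + X.iterHomotopy q (p + 1) (X.diff (p + 1) f) =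
      f - X.iterReduce q (p + 1) f := by
  induction q with
  | zero => simp [iterHomotopy, iterReduce]
  | succ q ih =>
    rw [iterHomotopy_succ_apply, iterHomotopy_succ_apply, iterReduce_succ_apply,
      reduce_succ_apply, ← X.diff_iterReduce, map_add,
      ← sub_eq_zero, ← sub_eq_zero.2 ih]
    abel

theorem iterHomotopy_diff_zero (q : ℕ) (f : C 0) : X.iterHomotopy q 0 (X.diff 0 f) = 0 := by
  induction q with
  | zero => rfl
  | succ q ih =>
    have h := X.reduce_zero q f
    rw [reduce_zero_apply, sub_eq_self] at h
    rw [iterHomotopy_succ_apply, ih, zero_add, ← X.diff_iterReduce, X.iterReduce_zero, h]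

/-- The projection onto the cochains killed by all codegeneracies. -/
def normalize (p : ℕ) : C p →ₗ[R] C p := X.iterReduce p p

theorem diff_normalize (p : ℕ) (f : C p) :
    X.diff p (X.normalize p f) = X.normalize (p + 1) (X.diff p f) := by
  rw [normalize, normalize, ← X.diff_iterReduce, X.iterReduce_of_le (p + 1) p (Nat.le_succ p)]

theorem codegen_normalize (p j : ℕ) (f : C (p + 1)) :
    X.codegen p j (X.normalize (p + 1) f) = 0 := by
  rcases Nat.lt_or_ge p j with h | h
  · simp [X.codegen_eq_zero p j h]
  · exact X.codegen_iterReduce (p + 1) p f j (by omega)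

theorem normalize_eq_self (p : ℕ) (f : C (p + 1)) (hf : ∀ j ≤ p, X.codegen p j f = 0) :
    X.normalize (p + 1) f = f := by
  have h : ∀ q ≤ p + 1, X.iterReduce q (p + 1) f = f := by
    intro q hq
    induction q with
    | zero => rfl
    | succ q ih =>
      rw [iterReduce_succ_apply, ih (by omega)]
      exact X.reduce_eq_self q p f fun j hj => hf j (by omega)
  exact h _ le_rfl

/-- The homotopy between the identity and the projection onto normalized cochains. -/
def normalizeHomotopy (p : ℕ) : C (p + 1) →ₗ[R] C p := X.iterHomotopy (p + 1) p

theorem diff_normalizeHomotopy_add (p : ℕ) (f : C (p + 1)) :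
    X.diff p (X.normalizeHomotopy p f) + X.normalizeHomotopy (p + 1) (X.diff (p + 1) f) =
      f - X.normalize (p + 1) f := by
  have h := X.diff_iterHomotopy_add (p + 2) p f
  rwa [X.iterHomotopy_of_le (p + 2) p (by omega),
    X.iterReduce_of_le (p + 2) (p + 1) (by omega)] at h

theorem normalizeHomotopy_diff_zero (f : C 0) : X.normalizeHomotopy 0 (X.diff 0 f) = 0 :=
  X.iterHomotopy_diff_zero 1 f

theorem normalize_zero (f : C 0) : X.normalize 0 f = f := rfl

end CosimplicialModule

end Normalization

/-! ### Degeneracies of the nerve -/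

theorem Fin.val_predAbove_eq_ite {n : ℕ} (j : Fin n) (k : Fin (n + 1)) :
    (j.predAbove k : ℕ) = if (j : ℕ) < k then (k : ℕ) - 1 else k := by
  simp only [Fin.predAbove, Fin.lt_def, Fin.val_castSucc]
  split_ifs <;> simp

theorem Fin.val_succAbove_eq_ite {n : ℕ} (i : Fin (n + 1)) (k : Fin n) :
    (i.succAbove k : ℕ) = if (k : ℕ) < i then (k : ℕ) else k + 1 := by
  simp only [Fin.succAbove, Fin.lt_def, Fin.val_castSucc]
  split_ifs <;> simp

section Groupoid

variable {EG EM G M : Type*}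
  [NormedAddCommGroup EG] [NormedSpace ℝ EG] [FiniteDimensional ℝ EG]
  [NormedAddCommGroup EM] [NormedSpace ℝ EM] [FiniteDimensional ℝ EM]
  [TopologicalSpace G] [ChartedSpace EG G] [IsManifold 𝓘(ℝ, EG) ∞ G] [T2Space G]
  [TopologicalSpace M] [ChartedSpace EM M] [IsManifold 𝓘(ℝ, EM) ∞ M] [T2Space M]

namespace LieGroupoid

variable (𝒢 : LieGroupoid EG EM G M)

/-- The arrows of the `j`-th degeneracy of a `p`-arrow: the unit at `m_j` is inserted as the arrow
number `j` (counted from `0`). -/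
def degenArrows {p : ℕ} (j : Fin (p + 1)) (m : Fin (p + 1) → M) (g : Fin p → G) :
    Fin (p + 1) → G := fun k =>
  if h : (k : ℕ) < j then g ⟨k, by omega⟩
  else if h' : (k : ℕ) = j then 𝒢.unit (m j)
  else g ⟨k - 1, by omega⟩

theorem degen_mem {p : ℕ} (j : Fin (p + 1)) {x : (Fin (p + 1) → M) × (Fin p → G)}
    (hx : x ∈ 𝒢.nerve p) :
    ((fun l => x.1 (j.predAbove l), 𝒢.degenArrows j x.1 x.2) :
      (Fin (p + 2) → M) × (Fin (p + 1) → G)) ∈ 𝒢.nerve (p + 1) := by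
  intro k
  simp only [degenArrows]
  split_ifs with h h'
  · rw [(hx _).1, (hx _).2]
    refine ⟨congrArg x.1 (Fin.ext ?_), congrArg x.1 (Fin.ext ?_)⟩ <;>
    · simp only [Fin.val_predAbove_eq_ite, Fin.val_castSucc, Fin.val_succ]
      split_ifs <;> omega
  · rw [𝒢.target_unit, 𝒢.source_unit]
    refine ⟨congrArg x.1 (Fin.ext ?_), congrArg x.1 (Fin.ext ?_)⟩ <;>
    · simp only [Fin.val_predAbove_eq_ite, Fin.val_castSucc, Fin.val_succ]
      split_ifs <;> omega
  · rw [(hx _).1, (hx _).2]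
    refine ⟨congrArg x.1 (Fin.ext ?_), congrArg x.1 (Fin.ext ?_)⟩ <;>
    · simp only [Fin.val_predAbove_eq_ite, Fin.val_castSucc, Fin.val_succ]
      split_ifs <;> omega

/-- The degeneracy map `B_p G → B_{p+1} G`, which repeats the `j`-th base point. -/
def degen {p : ℕ} (j : Fin (p + 1)) (x : 𝒢.nerve p) : 𝒢.nerve (p + 1) :=
  ⟨(fun l => x.1.1 (j.predAbove l), 𝒢.degenArrows j x.1.1 x.1.2), 𝒢.degen_mem j x.2⟩

theorem face_degen_castSucc {p : ℕ} (j : Fin (p + 1)) (x : 𝒢.nerve p) :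
    𝒢.face j.castSucc (𝒢.degen j x) = x := by
  obtain ⟨⟨m, g⟩, hx⟩ := x
  refine Subtype.ext (Prod.ext (funext fun k => ?_) (funext fun k => ?_))
  · refine congrArg m (Fin.ext ?_)
    simp only [Fin.val_predAbove_eq_ite, Fin.val_succAbove_eq_ite, Fin.val_castSucc]
    split_ifs <;> omega
  · have H : (k : ℕ) + 1 = j → 𝒢.mul (g k) (𝒢.unit (m j)) = g k := fun h => by
      have := 𝒢.mul_unit (g k)
      rwa [(hx k).2, show k.succ = j from Fin.ext (by simpa using h)] at this
    simp only [face, degen, faceArrows, degenArrows, Fin.val_castSucc, Fin.val_succ]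
    split_ifs <;> first | rfl | omega | exact H (by omega)

theorem face_degen_succ {p : ℕ} (j : Fin (p + 1)) (x : 𝒢.nerve p) :
    𝒢.face j.succ (𝒢.degen j x) = x := by
  obtain ⟨⟨m, g⟩, hx⟩ := x
  refine Subtype.ext (Prod.ext (funext fun k => ?_) (funext fun k => ?_))
  · refine congrArg m (Fin.ext ?_)
    simp only [Fin.val_predAbove_eq_ite, Fin.val_succAbove_eq_ite, Fin.val_succ]
    split_ifs <;> omega
  · have e (i : Fin p) (h : (i : ℕ) = k) : g i = g k := congrArg g (Fin.ext h)
    have H (i : Fin p) (h : (i : ℕ) = k) :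
        (k : ℕ) = j → 𝒢.mul (𝒢.unit (m j)) (g i) = g k := fun h' => by
      rw [e i h, ← show k.castSucc = j from Fin.ext (by simpa using h'),
        show m k.castSucc = 𝒢.target (g k) from (hx k).1.symm,
        𝒢.unit_mul]
    simp only [face, degen, faceArrows, degenArrows, Fin.val_castSucc, Fin.val_succ]
    split_ifs <;> first | rfl | omega | exact H _ (by simp) (by omega)

theorem face_degen_of_le {p : ℕ} (i : Fin (p + 2)) (j : Fin (p + 1)) (hij : (i : ℕ) ≤ j)
    (x : 𝒢.nerve (p + 1)) :
    𝒢.face i.castSucc (𝒢.degen j.succ x) = 𝒢.degen j (𝒢.face i x) := by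
  obtain ⟨⟨m, g⟩, hx⟩ := x
  refine Subtype.ext (Prod.ext (funext fun k => ?_) (funext fun k => ?_))
  · refine congrArg m (Fin.ext ?_)
    simp only [Fin.val_predAbove_eq_ite, Fin.val_succAbove_eq_ite, Fin.val_castSucc, Fin.val_succ]
    split_ifs <;> omega
  · have e (i i' : Fin (p + 1)) (h : (i : ℕ) = i') : g i = g i' := congrArg g (Fin.ext h)
    have em (i i' : Fin (p + 2)) (h : (i : ℕ) = i') : 𝒢.unit (m i) = 𝒢.unit (m i') := by
      rw [Fin.ext h]
    have hs : ((i.succAbove j : Fin (p + 2)) : ℕ) = j + 1 := by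
      rw [Fin.val_succAbove_eq_ite, if_neg (by omega)]
    simp only [face, degen, faceArrows, degenArrows, Fin.val_castSucc, Fin.val_succ]
    split_ifs <;> first
      | rfl | omega
      | exact em _ _ (by simp [hs])
      | exact e _ _ (by simp; try omega)

theorem face_degen_of_gt {p : ℕ} (i : Fin (p + 2)) (j : Fin (p + 1)) (hij : (j : ℕ) < i)
    (x : 𝒢.nerve (p + 1)) :
    𝒢.face i.succ (𝒢.degen j.castSucc x) = 𝒢.degen j (𝒢.face i x) := by
  obtain ⟨⟨m, g⟩, hx⟩ := x
  refine Subtype.ext (Prod.ext (funext fun k => ?_) (funext fun k => ?_))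
  · refine congrArg m (Fin.ext ?_)
    simp only [Fin.val_predAbove_eq_ite, Fin.val_succAbove_eq_ite, Fin.val_castSucc, Fin.val_succ]
    split_ifs <;> omega
  · have e (i i' : Fin (p + 1)) (h : (i : ℕ) = i') : g i = g i' := congrArg g (Fin.ext h)
    have em (i i' : Fin (p + 2)) (h : (i : ℕ) = i') : 𝒢.unit (m i) = 𝒢.unit (m i') := by
      rw [Fin.ext h]
    have hs : ((i.succAbove j : Fin (p + 2)) : ℕ) = j := by
      rw [Fin.val_succAbove_eq_ite, if_pos hij]
    simp only [face, degen, faceArrows, degenArrows, Fin.val_castSucc, Fin.val_succ]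
    split_ifs <;> first
      | rfl | omega
      | exact em _ _ (by simp [hs])
      | exact e _ _ (by simp; try omega)
      | exact congrArg₂ 𝒢.mul (e _ _ (by simp; try omega)) (e _ _ (by simp; try omega))

theorem degen_degen {p : ℕ} (i j : Fin (p + 1)) (hij : i ≤ j) (x : 𝒢.nerve p) :
    𝒢.degen i.castSucc (𝒢.degen j x) = 𝒢.degen j.succ (𝒢.degen i x) := by
  obtain ⟨⟨m, g⟩, hx⟩ := x
  rw [Fin.le_def] at hij
  refine Subtype.ext (Prod.ext (funext fun k => ?_) (funext fun k => ?_))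
  · refine congrArg m (Fin.ext ?_)
    simp only [Fin.val_predAbove_eq_ite, Fin.val_castSucc, Fin.val_succ]
    split_ifs <;> omega
  · have em (i i' : Fin (p + 1)) (h : (i : ℕ) = i') : 𝒢.unit (m i) = 𝒢.unit (m i') := by
      rw [Fin.ext h]
    have h1 : ((j.predAbove i.castSucc : Fin (p + 1)) : ℕ) = i := by
      rw [Fin.val_predAbove_eq_ite, Fin.val_castSucc, if_neg (by omega)]
    have h2 : ((i.predAbove j.succ : Fin (p + 1)) : ℕ) = j := by
      rw [Fin.val_predAbove_eq_ite, Fin.val_succ, if_pos (by omega), Nat.add_sub_cancel]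
    simp only [degen, degenArrows, Fin.val_castSucc, Fin.val_succ]
    split_ifs <;> first
      | rfl | omega
      | exact em _ _ (by simp [h1, h2])

/-! ### Degeneracies and the actions -/

/-- Repeating a base point other than the one acted upon commutes with the action; `l'` is the
position of the base point `m_l` after `m_j` has been repeated. -/
theorem degen_act_of_ne {p : ℕ} (j l : Fin (p + 1)) (hl : l ≠ j) (l' : Fin (p + 2))
    (hl' : (l' : ℕ) = if (l : ℕ) < j then (l : ℕ) else l + 1) (a : G) (x : 𝒢.nerve p)
    (ha : 𝒢.target a = x.1.1 l) (ha' : 𝒢.target a = (𝒢.degen j x).1.1 l') :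
    𝒢.degen j (𝒢.act l a x ha) = 𝒢.act l' a (𝒢.degen j x) ha' := by
  obtain ⟨⟨m, g⟩, hx⟩ := x
  have hl0 : (l : ℕ) ≠ j := fun h => hl (Fin.ext h)
  refine Subtype.ext (Prod.ext (funext fun k => ?_) (funext fun k => ?_))
  · have : j.predAbove k = l ↔ k = l' := by
      simp only [Fin.ext_iff, hl']
      simp only [Fin.val_predAbove_eq_ite]
      split_ifs <;> omega
    simp only [degen, act, Function.update_apply, this]
  · simp only [degen, degenArrows, act, actArrows, Function.update_apply, hl']
    split_ifs <;> first | rfl | omega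

/-- Acting at a repeated base point is acting at both of its copies. -/
theorem degen_act_self {p : ℕ} (j : Fin (p + 1)) (a : G) (x : 𝒢.nerve p)
    (ha : 𝒢.target a = x.1.1 j) (ha' : 𝒢.target a = (𝒢.degen j x).1.1 j.castSucc)
    (ha'' : 𝒢.target a = (𝒢.act j.castSucc a (𝒢.degen j x) ha').1.1 j.succ) :
    𝒢.degen j (𝒢.act j a x ha) =
      𝒢.act j.succ a (𝒢.act j.castSucc a (𝒢.degen j x) ha') ha'' := by
  obtain ⟨⟨m, g⟩, hx⟩ := x
  have ha0 : 𝒢.target a = m j := ha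
  refine Subtype.ext (Prod.ext (funext fun k => ?_) (funext fun k => ?_))
  · have : j.predAbove k = j ↔ (k = j.succ ∨ k = j.castSucc) := by
      simp only [Fin.ext_iff, Fin.val_succ]
      simp only [Fin.val_predAbove_eq_ite, Fin.val_castSucc]
      split_ifs <;> omega
    simp only [degen, act, Function.update_apply, this]
    split_ifs <;> simp_all
  · have e : 𝒢.unit (𝒢.source a) = 𝒢.mul (𝒢.mul (𝒢.inv a) (𝒢.unit (m j))) a := by
      rw [← ha0, ← 𝒢.source_inv, 𝒢.mul_unit, 𝒢.inv_mul]
    simp only [degen, degenArrows, act, actArrows, Function.update_self, Fin.val_castSucc,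
      Fin.val_succ]
    split_ifs <;> first | rfl | omega

/-- Acting on a `(p+1)`-arrow by its own arrow `g_j` at the base point `target g_j` turns this
arrow into a unit. -/
theorem act_eq_degen_face {p : ℕ} (j : Fin (p + 1)) (x : 𝒢.nerve (p + 1)) :
    𝒢.act j.castSucc (x.1.2 j) x (x.2 j).1 = 𝒢.degen j (𝒢.face j.castSucc x) := by
  obtain ⟨⟨m, g⟩, hx⟩ := x
  refine Subtype.ext (Prod.ext (funext fun k => ?_) (funext fun k => ?_))
  · simp only [degen, face, act, Function.update_apply]
    rw [(hx j).2]
    split_ifs with h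
    · subst h
      simp
    · refine congrArg m (Fin.ext ?_)
      rw [Fin.ext_iff, Fin.val_castSucc] at h
      simp only [Fin.val_predAbove_eq_ite, Fin.val_succAbove_eq_ite, Fin.val_castSucc]
      split_ifs <;> omega
  · have e (i i' : Fin (p + 1)) (h : (i : ℕ) = i') : g i = g i' := congrArg g (Fin.ext h)
    have hu (h : (k : ℕ) = j) : 𝒢.mul (𝒢.inv (g j)) (g k) =
        𝒢.unit (m (j.castSucc.succAbove j)) := by
      rw [e k j h, 𝒢.inv_mul, (hx j).2, Fin.succAbove_castSucc_self]
    have hm (i : Fin (p + 1)) (h : (k : ℕ) + 1 = j) (hi : (i : ℕ) = k + 1) :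
        𝒢.mul (g k) (g j) = 𝒢.mul (g k) (g i) := by rw [e i j (by omega)]
    simp only [degen, degenArrows, face, faceArrows, act, actArrows, Fin.val_castSucc]
    split_ifs <;> first
      | rfl | omega
      | exact hu (by omega)
      | exact hm _ (by omega) (by simp)
      | exact e _ _ (by simp; try omega)

/-! ### Invariant cochains as a cosimplicial vector space -/

theorem contMDiff_nerve_fst (p : ℕ) (j : Fin (p + 1)) : ContMDiff (𝒢.nerveModel p) 𝓘(ℝ, EM) ∞
    (fun x : (Fin (p + 1) → M) × (Fin p → G) => x.1 j) :=
  (contMDiff_powerManifold_apply j).comp contMDiff_fst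

theorem contMDiff_nerve_snd (p : ℕ) (j : Fin p) : ContMDiff (𝒢.nerveModel p) 𝓘(ℝ, EG) ∞
    (fun x : (Fin (p + 1) → M) × (Fin p → G) => x.2 j) :=
  (contMDiff_powerManifold_apply j).comp contMDiff_snd

theorem isSmoothCochain_comp_face {p : ℕ} {f : 𝒢.nerve p → ℝ} (hf : 𝒢.IsSmoothCochain f)
    (i : Fin (p + 2)) : 𝒢.IsSmoothCochain (fun x => f (𝒢.face i x)) := by
  obtain ⟨F, hF, hFf⟩ := hf
  refine ⟨fun x => F (fun j => x.1 (i.succAbove j), 𝒢.faceArrows i x.2), ?_,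
    fun x => hFf (𝒢.face i x)⟩
  refine hF.comp (ContMDiffOn.prodMk
    (contMDiffOn_powerManifold fun j => (𝒢.contMDiff_nerve_fst _ _).contMDiffOn)
    (contMDiffOn_powerManifold fun k => ?_)) fun x hx => 𝒢.face_mem i hx
  simp only [faceArrows]
  split_ifs
  · exact (𝒢.contMDiff_nerve_snd _ _).contMDiffOn
  · refine 𝒢.contMDiffOn_mul.comp ((𝒢.contMDiff_nerve_snd _ k.castSucc).contMDiffOn.prodMk
      (𝒢.contMDiff_nerve_snd _ k.succ).contMDiffOn) fun x hx => ?_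
    change 𝒢.source (x.2 k.castSucc) = 𝒢.target (x.2 k.succ)
    rw [(hx k.castSucc).2, (hx k.succ).1, Fin.succ_castSucc]
  · exact (𝒢.contMDiff_nerve_snd _ _).contMDiffOn

theorem isSmoothCochain_comp_degen {p : ℕ} {f : 𝒢.nerve (p + 1) → ℝ} (hf : 𝒢.IsSmoothCochain f)
    (j : Fin (p + 1)) : 𝒢.IsSmoothCochain (fun x => f (𝒢.degen j x)) := by
  obtain ⟨F, hF, hFf⟩ := hf
  refine ⟨fun x => F (fun l => x.1 (j.predAbove l), 𝒢.degenArrows j x.1 x.2), ?_,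
    fun x => hFf (𝒢.degen j x)⟩
  refine hF.comp (ContMDiffOn.prodMk
    (contMDiffOn_powerManifold fun j => (𝒢.contMDiff_nerve_fst _ _).contMDiffOn)
    (contMDiffOn_powerManifold fun k => ?_)) fun x hx => 𝒢.degen_mem j hx
  simp only [degenArrows]
  split_ifs
  · exact (𝒢.contMDiff_nerve_snd _ _).contMDiffOn
  · exact (𝒢.contMDiff_unit.comp (𝒢.contMDiff_nerve_fst _ _)).contMDiffOn
  · exact (𝒢.contMDiff_nerve_snd _ _).contMDiffOn

theorem isInvariantCochain_comp_face {A : Set G} {p : ℕ} {f : 𝒢.nerve p → ℝ}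
    (hf : 𝒢.IsInvariantCochain A f) (i : Fin (p + 2)) :
    𝒢.IsInvariantCochain A (fun x => f (𝒢.face i x)) := by
  intro l a haA x ha
  rcases eq_or_ne l i with rfl | h
  · simp only [face_act_self]
  · obtain ⟨l', rfl⟩ := Fin.exists_succAbove_eq h
    simp only [face_act_of_ne]
    exact hf l' a haA (𝒢.face i x) ha

theorem isInvariantCochain_comp_degen {A : Set G} {p : ℕ} {f : 𝒢.nerve (p + 1) → ℝ}
    (hf : 𝒢.IsInvariantCochain A f) (j : Fin (p + 1)) :
    𝒢.IsInvariantCochain A (fun x => f (𝒢.degen j x)) := by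
  intro l a haA x ha
  rcases eq_or_ne l j with rfl | h
  · have ha' : 𝒢.target a = (𝒢.degen l x).1.1 l.castSucc := by
      simpa [degen] using ha
    have ha'' : 𝒢.target a = (𝒢.act l.castSucc a (𝒢.degen l x) ha').1.1 l.succ := by
      simpa [act, degen, Function.update_of_ne (Fin.castSucc_lt_succ (i := l)).ne'] using ha
    dsimp only
    rw [𝒢.degen_act_self l a x ha ha' ha'', hf _ _ haA, hf _ _ haA]
  · obtain ⟨l', hl'⟩ : ∃ l' : Fin (p + 2), (l' : ℕ) = if (l : ℕ) < j then (l : ℕ) else l + 1 :=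
      ⟨⟨if (l : ℕ) < j then (l : ℕ) else l + 1, by split_ifs <;> omega⟩, rfl⟩
    have hl0 : (l : ℕ) ≠ j := fun h' => h (Fin.ext h')
    have ha' : 𝒢.target a = (𝒢.degen j x).1.1 l' := by
      rw [ha]
      refine congrArg x.1.1 (Fin.ext ?_)
      rw [Fin.val_predAbove_eq_ite, hl']
      split_ifs <;> omega
    dsimp only
    rw [𝒢.degen_act_of_ne j l h l' hl' a x ha ha', hf _ _ haA]

/-- Pullback of invariant cochains along the `i`-th face map, and zero for `i` out of range. -/
def invariantCoface (A : Set G) (p i : ℕ) :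
    𝒢.invariantCochains A p →ₗ[ℝ] 𝒢.invariantCochains A (p + 1) :=
  if h : i < p + 2 then
    (LinearMap.funLeft ℝ ℝ (𝒢.face ⟨i, h⟩)).restrict fun _ hf =>
      ⟨𝒢.isSmoothCochain_comp_face hf.1 _, 𝒢.isInvariantCochain_comp_face hf.2 _⟩
  else 0

/-- Pullback of invariant cochains along the `j`-th degeneracy map, and zero for `j` out of
range. -/
def invariantCodegen (A : Set G) (p j : ℕ) :
    𝒢.invariantCochains A (p + 1) →ₗ[ℝ] 𝒢.invariantCochains A p :=
  if h : j < p + 1 then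
    (LinearMap.funLeft ℝ ℝ (𝒢.degen ⟨j, h⟩)).restrict fun _ hf =>
      ⟨𝒢.isSmoothCochain_comp_degen hf.1 _, 𝒢.isInvariantCochain_comp_degen hf.2 _⟩
  else 0

variable {𝒢} in
theorem invariantCoface_apply {A : Set G} {p i : ℕ} (h : i < p + 2)
    (f : 𝒢.invariantCochains A p) (x : 𝒢.nerve (p + 1)) :
    (𝒢.invariantCoface A p i f).1 x = f.1 (𝒢.face ⟨i, h⟩ x) := by
  rw [invariantCoface, dif_pos h]
  rfl

variable {𝒢} in
theorem invariantCodegen_apply {A : Set G} {p j : ℕ} (h : j < p + 1)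
    (f : 𝒢.invariantCochains A (p + 1)) (x : 𝒢.nerve p) :
    (𝒢.invariantCodegen A p j f).1 x = f.1 (𝒢.degen ⟨j, h⟩ x) := by
  rw [invariantCodegen, dif_pos h]
  rfl

theorem sum_invariantCoface (A : Set G) (p : ℕ) (f : 𝒢.invariantCochains A p) :
    ∑ i ∈ Finset.range (p + 2), (-1 : ℝ) ^ i • 𝒢.invariantCoface A p i f =
      (𝒢.coboundary p).restrict (𝒢.coboundary_mem_invariant A p) f := by
  refine Subtype.ext (funext fun x => ?_)
  rw [Finset.sum_range, Submodule.coe_sum, Finset.sum_apply]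
  refine Finset.sum_congr rfl fun i _ => ?_
  rw [Submodule.coe_smul, Pi.smul_apply, invariantCoface_apply i.2]
  rfl

/-- The cosimplicial vector space of cochains invariant under `A`. -/
def invariantCosimplicial (A : Set G) :
    CosimplicialModule ℝ (fun p => 𝒢.invariantCochains A p) where
  coface := 𝒢.invariantCoface A
  codegen := 𝒢.invariantCodegen A
  codegen_eq_zero p j hj := by rw [invariantCodegen, dif_neg (by omega)]
  codegen_coface_of_lt p i j hij hj f := by
    refine Subtype.ext (funext fun x => ?_)
    rw [invariantCodegen_apply (by omega), invariantCoface_apply (by omega),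
      invariantCoface_apply (by omega), invariantCodegen_apply (by omega)]
    exact congrArg f.1 (𝒢.face_degen_of_le ⟨i, by omega⟩ ⟨j, by omega⟩ hij x)
  codegen_coface_self p j hj f := by
    refine Subtype.ext (funext fun x => ?_)
    rw [invariantCodegen_apply (by omega), invariantCoface_apply (by omega)]
    exact congrArg f.1 (𝒢.face_degen_castSucc ⟨j, by omega⟩ x)
  codegen_coface_succ p j hj f := by
    refine Subtype.ext (funext fun x => ?_)
    rw [invariantCodegen_apply (by omega), invariantCoface_apply (by omega)]
    exact congrArg f.1 (𝒢.face_degen_succ ⟨j, by omega⟩ x)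
  codegen_coface_of_gt p i j hij hi f := by
    refine Subtype.ext (funext fun x => ?_)
    rw [invariantCodegen_apply (by omega), invariantCoface_apply (by omega),
      invariantCoface_apply (by omega), invariantCodegen_apply (by omega)]
    exact congrArg f.1 (𝒢.face_degen_of_gt ⟨i, by omega⟩ ⟨j, by omega⟩ hij x)
  codegen_codegen p i j hij f := by
    rcases Nat.lt_or_ge p j with h | h
    · rw [invariantCodegen, dif_neg (by omega), LinearMap.zero_apply,
        show 𝒢.invariantCodegen A (p + 1) (j + 1) = 0 by rw [invariantCodegen, dif_neg (by omega)],
        LinearMap.zero_apply, map_zero]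
    · refine Subtype.ext (funext fun x => ?_)
      rw [invariantCodegen_apply (by omega), invariantCodegen_apply (by omega),
        invariantCodegen_apply (by omega), invariantCodegen_apply (by omega)]
      exact congrArg f.1 (𝒢.degen_degen ⟨i, by omega⟩ ⟨j, by omega⟩ (by simpa using hij) x)
  sum_coface_sum_coface p f := by
    rw [sum_invariantCoface, sum_invariantCoface]
    exact Subtype.ext (𝒢.coboundary_coboundary p f.1)

theorem invariantCosimplicial_diff (A : Set G) (p : ℕ) :
    (𝒢.invariantCosimplicial A).diff p =
      (𝒢.coboundary p).restrict (𝒢.coboundary_mem_invariant A p) := by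
  refine LinearMap.ext fun f => ?_
  rw [CosimplicialModule.diff_apply]
  exact 𝒢.sum_invariantCoface A p f

/-- An invariant cochain vanishes on all `p`-arrows with an arrow in `A` as soon as it vanishes on
those with a unit: acting by an arrow of `A` turns it into a unit. -/
theorem isNormalizedCochain_iff {A : Set G} (hA : ∀ m, 𝒢.unit m ∈ A) (p : ℕ)
    (f : 𝒢.invariantCochains A (p + 1)) :
    𝒢.IsNormalizedCochain A f.1 ↔ ∀ j ≤ p, (𝒢.invariantCosimplicial A).codegen p j f = 0 := by
  constructor
  · intro hf j hj
    refine Subtype.ext (funext fun x => ?_)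
    refine (invariantCodegen_apply (by omega : j < p + 1) f x).trans (hf _ ⟨j, by omega⟩ ?_)
    simpa [degen, degenArrows] using hA _
  · intro hf x j hj
    rw [← f.2.2 j.castSucc _ hj x (x.2 j).1, 𝒢.act_eq_degen_face j x,
      ← invariantCodegen_apply j.2 f]
    have h := hf j (by omega)
    change 𝒢.invariantCodegen A p j f = 0 at h
    rw [h]
    rfl

/-! ### The homotopy equivalence -/

theorem normalize_mem {A : Set G} (hA : ∀ m, 𝒢.unit m ∈ A) (p : ℕ)
    (f : 𝒢.invariantCochains A p) :
    ((𝒢.invariantCosimplicial A).normalize p f).1 ∈ 𝒢.normalizedInvariantCochains A p := by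
  refine ⟨((𝒢.invariantCosimplicial A).normalize p f).2, ?_⟩
  cases p with
  | zero => exact fun _ i => i.elim0
  | succ p =>
    exact (𝒢.isNormalizedCochain_iff hA p _).2 fun j _ =>
      (𝒢.invariantCosimplicial A).codegen_normalize p j f

theorem normalize_inclusion {A : Set G} (hA : ∀ m, 𝒢.unit m ∈ A) (p : ℕ)
    (f : 𝒢.normalizedInvariantCochains A p) :
    (𝒢.invariantCosimplicial A).normalize p
        (Submodule.inclusion (𝒢.normalizedInvariantCochains_le A p) f) =
      Submodule.inclusion (𝒢.normalizedInvariantCochains_le A p) f := by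
  cases p with
  | zero => rfl
  | succ p =>
    exact (𝒢.invariantCosimplicial A).normalize_eq_self p _
      ((𝒢.isNormalizedCochain_iff hA p _).1 f.2.2)

/-- The projection onto normalized cochains, as a linear map into the space of these. -/
def normalizeRestrict {A : Set G} (hA : ∀ m, 𝒢.unit m ∈ A) (p : ℕ) :
    𝒢.invariantCochains A p →ₗ[ℝ] 𝒢.normalizedInvariantCochains A p :=
  LinearMap.codRestrict _ ((Submodule.subtype _) ∘ₗ (𝒢.invariantCosimplicial A).normalize p)
    (𝒢.normalize_mem hA p)

/-- The projection of the invariant complex onto the normalized one. -/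
noncomputable def normalizedProjection {A : Set G} (hA : ∀ m, 𝒢.unit m ∈ A) :
    𝒢.invariantComplex A ⟶ 𝒢.normalizedInvariantComplex A :=
  CochainComplex.ofHom
    (fun p => ModuleCat.ofHom (𝒢.normalizeRestrict hA p))
    (fun p => by
      simp only [normalizedInvariantComplex, invariantComplex, subcomplex_d]
      refine ModuleCat.hom_ext (LinearMap.ext fun (f : 𝒢.invariantCochains A p) => Subtype.ext ?_)
      have h := (𝒢.invariantCosimplicial A).diff_normalize p f
      simp only [invariantCosimplicial_diff] at h
      have h' := congrArg Subtype.val h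
      exact h')

theorem normalizedInclusion_projection {A : Set G} (hA : ∀ m, 𝒢.unit m ∈ A) :
    𝒢.normalizedInclusion A ≫ 𝒢.normalizedProjection hA = 𝟙 _ := by
  refine HomologicalComplex.hom_ext _ _ fun p =>
    ModuleCat.hom_ext (LinearMap.ext fun f => Subtype.ext ?_)
  have h := congrArg Subtype.val (𝒢.normalize_inclusion hA p f)
  exact h

/-- The homotopy between the projection onto normalized cochains and the identity of the invariant
complex. -/
noncomputable def projectionInclusionHomotopy {A : Set G} (hA : ∀ m, 𝒢.unit m ∈ A) :
    Homotopy (𝟙 (𝒢.invariantComplex A))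
      (𝒢.normalizedProjection hA ≫ 𝒢.normalizedInclusion A) where
  hom i j := if h : j + 1 = i then
      eqToHom (by rw [h]) ≫
        (show (𝒢.invariantComplex A).X (j + 1) ⟶ (𝒢.invariantComplex A).X j from ModuleCat.ofHom ((𝒢.invariantCosimplicial A).normalizeHomotopy j))
    else 0
  zero i j h := dif_neg h
  comm p := by
    have hd (q : ℕ) : (𝒢.invariantComplex A).d q (q + 1) =
        ModuleCat.ofHom ((𝒢.invariantCosimplicial A).diff q) := by
      rw [invariantCosimplicial_diff]
      exact 𝒢.subcomplex_d _ _ q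
    cases p with
    | zero =>
      rw [Homotopy.dNext_cochainComplex, Homotopy.prevD_zero_cochainComplex, dif_pos rfl, hd]
      refine ModuleCat.hom_ext (LinearMap.ext fun (f : 𝒢.invariantCochains A 0) => ?_)
      change f = (𝒢.invariantCosimplicial A).normalizeHomotopy 0
          ((𝒢.invariantCosimplicial A).diff 0 f) + 0 + (𝒢.invariantCosimplicial A).normalize 0 f
      rw [(𝒢.invariantCosimplicial A).normalizeHomotopy_diff_zero,
        (𝒢.invariantCosimplicial A).normalize_zero, add_zero]
      exact (zero_add f).symm
    | succ p =>
      rw [Homotopy.dNext_cochainComplex, Homotopy.prevD_succ_cochainComplex, dif_pos rfl,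
        dif_pos rfl, hd, hd]
      refine ModuleCat.hom_ext (LinearMap.ext fun (f : 𝒢.invariantCochains A (p + 1)) => ?_)
      have h := (𝒢.invariantCosimplicial A).diff_normalizeHomotopy_add p f
      change f = (𝒢.invariantCosimplicial A).normalizeHomotopy (p + 1)
          ((𝒢.invariantCosimplicial A).diff (p + 1) f) +
        (𝒢.invariantCosimplicial A).diff p
          ((𝒢.invariantCosimplicial A).normalizeHomotopy p f) +
        (𝒢.invariantCosimplicial A).normalize (p + 1) f
      rw [add_comm ((𝒢.invariantCosimplicial A).normalizeHomotopy (p + 1) _), h, sub_add_cancel]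

end LieGroupoid

end Groupoid

theorem mainTheorem2 {EG EM EK G M K : Type*}
    [NormedAddCommGroup EG] [NormedSpace ℝ EG] [FiniteDimensional ℝ EG]
    [NormedAddCommGroup EM] [NormedSpace ℝ EM] [FiniteDimensional ℝ EM]
    [NormedAddCommGroup EK] [NormedSpace ℝ EK] [FiniteDimensional ℝ EK]
    [TopologicalSpace G] [ChartedSpace EG G] [IsManifold 𝓘(ℝ, EG) ∞ G] [T2Space G]
    [TopologicalSpace M] [ChartedSpace EM M] [IsManifold 𝓘(ℝ, EM) ∞ M] [T2Space M]
    [TopologicalSpace K] [ChartedSpace EK K] [IsManifold 𝓘(ℝ, EK) ∞ K] [T2Space K]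
    (𝒢 : LieGroupoid EG EM G M) (𝒦 : WideLieSubgroupoid EK K 𝒢) :
    ∃ e : HomotopyEquiv (𝒢.normalizedInvariantComplex 𝒦.arrows) (𝒢.invariantComplex 𝒦.arrows),
      e.hom = 𝒢.normalizedInclusion 𝒦.arrows := by
  have hA : ∀ m, 𝒢.unit m ∈ 𝒦.arrows := fun m => ⟨𝒦.unit m, 𝒦.incl_unit m⟩
  exact ⟨{
    hom := 𝒢.normalizedInclusion 𝒦.arrows
    inv := 𝒢.normalizedProjection hA
    homotopyHomInvId := Homotopy.ofEq (𝒢.normalizedInclusion_projection hA)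
    homotopyInvHomId := (𝒢.projectionInclusionHomotopy hA).symm }, rfl⟩
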